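/- Let $K$ be an algebraically closed field and $A$ a finite-dimensional $K$-algebra (associative, unital). "Module" means finite-dimensional left $A$-module. Write $D=\operatorname{Hom}_K(-,K)$. For a module $M$ with minimal projective presentation $P_1\xrightarrow{f}P_0\to M\to 0$, let $\operatorname{Tr}M=\operatorname{coker}\bigl(\operatorname{Hom}_A(f,A)\colon\operatorname{Hom}_A(P_0,A)\to\operatorname{Hom}_A(P_1,A)\bigr)$, a right $A$-module, and let $\tau M=D\operatorname{Tr}M$ be the Auslander–Reiten translate. Call $M$ $\tau$-rigid if $\operatorname{Hom}_A(M,\tau M)=0$. A module class is a full subcategory $\mathcal C$ of the category of modules that is closed under isomorphisms and satisfies $X\oplus Y\in\mathcal C$ if and only if $X\in\mathcal C$ and $Y\in\mathcal C$. Let $\operatorname{add}N$ be the smallest module class containing $N$, and let $\operatorname{gen}N$ be the class of all modules that are quotients of a module in $\operatorname{add}N$. Write $\operatorname{Ext}^1_A(M,\mathcal C)=0$ if $\operatorname{Ext}^1_A(M,X)=0$ for all $X\in\mathcal C$. A module class $\mathcal T$ is a torsion class if there is a module class $\mathcal F$ with $\operatorname{Hom}_A(X,Y)=0$ for all $X\in\mathcal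 T$, $Y\in\mathcal F$, such that every module $X$ fits into a short exact sequence $0\to X'\to X\to X''\to 0$ with $X'\in\mathcal T$ and $X''\in\mathcal F$. A $\mathcal C$-envelope of $X$ is a map $\theta\colon X\to C$ with $C\in\mathcal C$ through which every map from $X$ to a module in $\mathcal C$ factors, and such that every $\alpha\in\operatorname{End}_A(C)$ with $\alpha\theta=\theta$ is invertible; $\mathcal C$-covers are defined dually. The class $\mathcal C$ is functorially finite if every module has a $\mathcal C$-envelope and a $\mathcal C$-cover. **Lemma (Auslander–Smalø).** For all modules $M$ and $N$, $$\operatorname{Hom}_A(N,\tau M)=0\iff\operatorname{Ext}^1_A(M,\operatorname{gen}N)=0.$$ In particular, a module $M$ is $\tau$-rigid if and only if $\operatorname{Ext}^1_A(M,\operatorname{gen}M)=0$, and in that case $\operatorname{gen}M$ is a functorially finite torsion class. -/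

import Mathlib

open CategoryTheory

universe w u

/-! ### Minimal projective presentations -/

section ProjectiveCover

variable {A : Type u} [Ring A]

/-- A submodule `S` of `X` is superfluous if `T + S = X` forces `T = X`. -/
def IsSuperfluous {X : Type*} [AddCommGroup X] [Module A X] (S : Submodule A X) : Prop :=
  ∀ T : Submodule A X, T ⊔ S = ⊤ → T = ⊤

/-- A minimal projective presentation `P₁ → P₀ → M → 0` of `M` by finitely generated projective
modules: `P₀ → M` and `P₁ → ker (P₀ → M)` are projective covers. -/
structure MinProjPresentation (A : Type u) [Ring A] (M : Type u) [AddCommGroup M] [Module A M] where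
  P₀ : FGModuleCat.{u} A
  P₁ : FGModuleCat.{u} A
  projective₀ : Module.Projective A P₀
  projective₁ : Module.Projective A P₁
  p : P₀ →ₗ[A] M
  f : P₁ →ₗ[A] P₀
  surjective_p : Function.Surjective p
  exact : LinearMap.range f = LinearMap.ker p
  superfluous_p : IsSuperfluous (LinearMap.ker p)
  superfluous_f : IsSuperfluous (LinearMap.ker f)

/-- Finitely generated modules over an Artinian ring have projective covers. -/
theorem exists_projectiveCover [IsArtinianRing A] (M : Type u) [AddCommGroup M] [Module A M]
    [Module.Finite A M] :
    ∃ (P : FGModuleCat.{u} A) (p : P →ₗ[A] M), Module.Projective A P ∧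
      Function.Surjective p ∧ IsSuperfluous (LinearMap.ker p) := by
  obtain ⟨n, q, hq⟩ := Module.Finite.exists_fin' A M
  let s : Set (Submodule A (Fin n → A)) := {S | Module.Projective A S ∧ S.map q = ⊤}
  have hs : s.Nonempty := by
    refine ⟨⊤, Module.Projective.of_equiv (Submodule.topEquiv (R := A) (M := Fin n → A)).symm, ?_⟩
    rw [Submodule.map_top, LinearMap.range_eq_top.2 hq]
  obtain ⟨S, ⟨hSP, hSq⟩, hmin⟩ := IsArtinian.set_has_minimal s hs
  have hsurj : Function.Surjective (q.domRestrict S) := by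
    rw [← LinearMap.range_eq_top, LinearMap.range_domRestrict, hSq]
  refine ⟨FGModuleCat.of A S, q.domRestrict S, hSP, hsurj, ?_⟩
  intro (T : Submodule A S) hT
  have hTsurj : Function.Surjective ((q.domRestrict S).domRestrict T) := by
    intro m
    obtain ⟨x, rfl⟩ := hsurj m
    have hx : x ∈ T ⊔ LinearMap.ker (q.domRestrict S) := by rw [hT]; trivial
    obtain ⟨t, ht, k, hk, rfl⟩ := Submodule.mem_sup.1 hx
    refine ⟨⟨t, ht⟩, ?_⟩
    rw [map_add, LinearMap.mem_ker.1 hk, add_zero]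
    rfl
  obtain ⟨h, hh⟩ := Module.projective_lifting_property _ (q.domRestrict S) hTsurj
  let g : Module.End A S := T.subtype ∘ₗ h
  have hg : ∀ x, q.domRestrict S (g x) = q.domRestrict S x := fun x ↦ LinearMap.congr_fun hh x
  have hgn : ∀ (k : ℕ) (x), q.domRestrict S ((g ^ k) x) = q.domRestrict S x := by
    intro k
    induction k with
    | zero => intro x; rfl
    | succ k ih => intro x; rw [pow_succ, Module.End.mul_apply, ih, hg]
  obtain ⟨k, hk, hk1⟩ := (g.eventually_isCompl_ker_pow_range_pow.and
    (Filter.eventually_ge_atTop 1)).exists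
  let R : Submodule A S := LinearMap.range (g ^ k)
  have hRP : Module.Projective A R :=
    Module.Projective.of_split R.subtype (R.projectionOnto _ hk.symm)
      (by ext x; simp)
  have hR : R.map S.subtype = S := by
    by_contra hne
    refine hmin (R.map S.subtype) ⟨?_, ?_⟩ (lt_of_le_of_ne (Submodule.map_subtype_le S R) hne)
    · exact Module.Projective.of_equiv
        (Submodule.equivMapOfInjective S.subtype S.injective_subtype R)
    · rw [eq_top_iff]
      intro m _
      obtain ⟨x, rfl⟩ := hsurj m
      exact ⟨_, ⟨(g ^ k) x, ⟨x, rfl⟩, rfl⟩, hgn k x⟩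
  rw [eq_top_iff]
  intro x _
  have hx : (x : Fin n → A) ∈ R.map S.subtype := by rw [hR]; exact x.2
  obtain ⟨y, ⟨z, hz⟩, hy⟩ := hx
  have hyx : y = x := Subtype.ext hy
  obtain ⟨j, rfl⟩ : ∃ j, k = j + 1 := ⟨k - 1, by omega⟩
  rw [pow_succ', Module.End.mul_apply] at hz
  rw [← hyx, ← hz]
  exact (h ((g ^ j) z)).2

theorem MinProjPresentation.nonempty [IsArtinianRing A] (M : Type u) [AddCommGroup M] [Module A M]
    [Module.Finite A M] : Nonempty (MinProjPresentation A M) := by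
  obtain ⟨P₀, p, hP₀, hp, hp'⟩ := exists_projectiveCover (A := A) M
  obtain ⟨P₁, f, hP₁, hf, hf'⟩ := exists_projectiveCover (A := A) (LinearMap.ker p)
  refine ⟨⟨P₀, P₁, hP₀, hP₁, p, (LinearMap.ker p).subtype ∘ₗ f, hp, ?_, hp', ?_⟩⟩
  · rw [LinearMap.range_comp, LinearMap.range_eq_top.2 hf, Submodule.map_top, Submodule.range_subtype]
  · rwa [LinearMap.ker_comp_of_ker_eq_bot _ (Submodule.ker_subtype _)]

end ProjectiveCover

/-! ### The Auslander–Reiten translate -/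

section Translate

/-- The right `A`-linear map `Hom_A(f, A) : Hom_A(Y, A) → Hom_A(X, A)`. -/
def homDualMap {A : Type*} [Ring A] {X Y : Type*} [AddCommGroup X] [Module A X]
    [AddCommGroup Y] [Module A Y] (f : X →ₗ[A] Y) : (Y →ₗ[A] A) →ₗ[Aᵐᵒᵖ] (X →ₗ[A] A) where
  toFun φ := φ ∘ₗ f
  map_add' _ _ := rfl
  map_smul' _ _ := rfl

/-- The standard duality `D = Hom_K(-, K)`, from right `A`-modules to left `A`-modules. -/
def StdDual (K : Type*) [Field K] (X : Type*) [AddCommGroup X] [Module K X] : Type _ :=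
  X →ₗ[K] K

namespace StdDual

variable (K : Type*) [Field K] (X : Type*) [AddCommGroup X] [Module K X]

instance : AddCommGroup (StdDual K X) := inferInstanceAs (AddCommGroup (X →ₗ[K] K))

instance : FunLike (StdDual K X) X K := inferInstanceAs (FunLike (X →ₗ[K] K) X K)

instance : LinearMapClass (StdDual K X) K X K :=
  inferInstanceAs (LinearMapClass (X →ₗ[K] K) K X K)

/-- The left action on the dual is `(a • φ) x = φ (x • a)`. -/
instance {A : Type*} [Ring A] [Module Aᵐᵒᵖ X] [SMulCommClass Aᵐᵒᵖ K X] :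
    Module A (StdDual K X) where
  smul a φ := LinearMap.comp (M₂ := X) φ (Module.toModuleEnd K X (MulOpposite.op a))
  one_smul φ := DFunLike.ext _ _ fun x ↦ congrArg φ (one_smul Aᵐᵒᵖ x)
  mul_smul a b φ := DFunLike.ext _ _ fun x ↦
    congrArg φ (mul_smul (MulOpposite.op b) (MulOpposite.op a) x)
  smul_zero _ := rfl
  smul_add _ _ _ := rfl
  add_smul a b φ := DFunLike.ext _ _ fun x ↦
    (congrArg φ (add_smul (MulOpposite.op a) (MulOpposite.op b) x)).trans (map_add φ _ _)
  zero_smul φ := DFunLike.ext _ _ fun x ↦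
    (congrArg φ (zero_smul Aᵐᵒᵖ x)).trans (map_zero φ)

theorem smul_apply {A : Type*} [Ring A] [Module Aᵐᵒᵖ X] [SMulCommClass Aᵐᵒᵖ K X]
    (a : A) (φ : StdDual K X) (x : X) : (a • φ) x = φ (MulOpposite.op a • x) := rfl

end StdDual

variable {A : Type u} [Ring A]

/-- The transpose `Tr M`, computed from a minimal projective presentation of `M`: the cokernel of
`Hom_A(P₀, A) → Hom_A(P₁, A)`. -/
abbrev MinProjPresentation.Transpose {M : Type u} [AddCommGroup M] [Module A M]
    (P : MinProjPresentation A M) : Type u :=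
  (P.P₁ →ₗ[A] A) ⧸ LinearMap.range (homDualMap P.f)

variable (K : Type w) [Field K] [Algebra K A] [Module.Finite K A]

/-- A choice of a minimal projective presentation of a finitely generated module over a
finite-dimensional algebra. -/
noncomputable def minProjPresentation (M : FGModuleCat.{u} A) : MinProjPresentation A M :=
  haveI : IsArtinianRing A := IsArtinianRing.of_finite K A
  Classical.choice (MinProjPresentation.nonempty (A := A) M)

/-- The Auslander–Reiten translate `τ M = D Tr M`. -/
abbrev ARTranslate (M : FGModuleCat.{u} A) : Type (max u w) :=
  StdDual K (minProjPresentation K M).Transpose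

/-- `M` is `τ`-rigid if `Hom_A(M, τ M) = 0`. -/
def IsTauRigid (M : FGModuleCat.{u} A) : Prop :=
  ∀ g : M →ₗ[A] ARTranslate K M, g = 0

end Translate

/-! ### Module classes, torsion classes, approximations

Over a finite-dimensional algebra `A`, the objects of `FGModuleCat A` are exactly the
finite-dimensional left `A`-modules; a full subcategory is given by a property of objects. -/

section ModuleClass

variable {A : Type u} [Ring A]

/-- Module classes: closed under isomorphisms, and `X ⊕ Y ∈ C` iff `X ∈ C` and `Y ∈ C`. -/
structure IsModuleClass (C : ObjectProperty (FGModuleCat.{u} A)) : Prop where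
  iso : ∀ X Y : FGModuleCat.{u} A, Nonempty (X ≃ₗ[A] Y) → C X → C Y
  sum : ∀ X Y : FGModuleCat.{u} A, (C X ∧ C Y) ↔ C (FGModuleCat.of A (X × Y))

/-- `add M`, the smallest module class containing `M`. -/
def addClass (M : FGModuleCat.{u} A) : ObjectProperty (FGModuleCat.{u} A) :=
  fun X ↦ ∀ C : ObjectProperty (FGModuleCat.{u} A), IsModuleClass C → C M → C X

/-- `gen M`, the class of quotients of modules in `add M`. -/
def genClass (M : FGModuleCat.{u} A) : ObjectProperty (FGModuleCat.{u} A) :=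
  fun X ↦ ∃ M₀ : FGModuleCat.{u} A, addClass M M₀ ∧
    ∃ q : M₀ →ₗ[A] X, Function.Surjective q

/-- `Ext¹_A(M, C) = 0`, i.e. `Ext¹_A(M, X) = 0` for all `X` in the class `C`. -/
def ExtOneVanishes (M : FGModuleCat.{u} A) (C : ObjectProperty (FGModuleCat.{u} A)) : Prop :=
  ∀ X : FGModuleCat.{u} A, C X → ∀ e : Abelian.Ext.{u} M.obj X.obj 1, e = 0

/-- Torsion theories `(T, F)` in the category of finitely generated modules. -/
structure IsTorsionTheory (T F : ObjectProperty (FGModuleCat.{u} A)) : Prop where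
  torsion : IsModuleClass T
  torsionFree : IsModuleClass F
  hom_eq_zero : ∀ X Y : FGModuleCat.{u} A, T X → F Y → ∀ g : X →ₗ[A] Y, g = 0
  exists_exact : ∀ X : FGModuleCat.{u} A, ∃ X' X'' : FGModuleCat.{u} A, T X' ∧ F X'' ∧
    ∃ (i : X' →ₗ[A] X) (π : X →ₗ[A] X''),
      Function.Injective i ∧ Function.Exact i π ∧ Function.Surjective π

def IsTorsionClass (T : ObjectProperty (FGModuleCat.{u} A)) : Prop :=
  ∃ F, IsTorsionTheory T F

/-- `θ : X → Y` is a `C`-envelope: `Y ∈ C`, every map from `X` to a module in `C` factors through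
`θ`, and `θ` is codomain minimal (left minimal). -/
structure IsEnvelope (C : ObjectProperty (FGModuleCat.{u} A)) {X Y : FGModuleCat.{u} A}
    (θ : X →ₗ[A] Y) : Prop where
  mem : C Y
  factor : ∀ Z : FGModuleCat.{u} A, C Z → ∀ g : X →ₗ[A] Z, ∃ g' : Y →ₗ[A] Z, g' ∘ₗ θ = g
  minimal : ∀ α : Y →ₗ[A] Y, α ∘ₗ θ = θ → Function.Bijective α

/-- `θ : Y → X` is a `C`-cover: `Y ∈ C`, every map from a module in `C` to `X` factors through
`θ`, and `θ` is domain minimal (right minimal). -/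
structure IsCover (C : ObjectProperty (FGModuleCat.{u} A)) {X Y : FGModuleCat.{u} A}
    (θ : Y →ₗ[A] X) : Prop where
  mem : C Y
  factor : ∀ Z : FGModuleCat.{u} A, C Z → ∀ g : Z →ₗ[A] X, ∃ g' : Z →ₗ[A] Y, θ ∘ₗ g' = g
  minimal : ∀ β : Y →ₗ[A] Y, θ ∘ₗ β = θ → Function.Bijective β

def IsCovariantlyFinite (C : ObjectProperty (FGModuleCat.{u} A)) : Prop :=
  ∀ X : FGModuleCat.{u} A, ∃ (Y : FGModuleCat.{u} A) (θ : X →ₗ[A] Y), IsEnvelope C θ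

def IsContravariantlyFinite (C : ObjectProperty (FGModuleCat.{u} A)) : Prop :=
  ∀ X : FGModuleCat.{u} A, ∃ (Y : FGModuleCat.{u} A) (θ : Y →ₗ[A] X), IsCover C θ

def IsFunctoriallyFinite (C : ObjectProperty (FGModuleCat.{u} A)) : Prop :=
  IsCovariantlyFinite C ∧ IsContravariantlyFinite C

end ModuleClass

/-! Both sides of the equivalence say the same thing: (*) every map `P₁ → N` extends along `f` to
`P₀`. Since `P₁` and `P₀` are finitely generated projective, Hom_A(Pᵢ, A) ⊗ N ≅ Hom_A(Pᵢ, N), so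
Hom_A(N, D Tr M) is the dual of Tr M ⊗ N, the cokernel of Hom_A(P₀, N) → Hom_A(P₁, N).
`hom_dual_transpose_eq_zero_iff` carries this out with rank-one maps and dual bases. On the other
side, Ext¹(M, X) = 0 means that maps from ker p = im f to X extend to `P₀`. Projectivity of `P₁`
carries (*) from N to quotients of powers of N, which make up gen N, and (*) for X kills Ext¹(M, X).
Conversely, minimality of the presentation recovers (*) from Ext-vanishing on quotients of N
(`exists_extension`). If Ext¹(M, gen M) = 0, the trace T of M in X is the torsion part: maps M → X/T
lift to X, hence land in T. The inclusion of T is also the gen M-cover, and an envelope is a left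
approximation of minimal length. -/

/-! ### Vanishing of Ext¹ as a lifting and an extension property -/

section Ext

open Abelian

variable {C : Type*} [Category* C] [Abelian C] [HasExt.{w} C]

/-- If `Ext¹(M, S.X₁) = 0`, then maps `M ⟶ S.X₃` lift along the epimorphism of a short exact
sequence `S`. -/
theorem CategoryTheory.ShortComplex.ShortExact.exists_lift_of_ext_one_eq_zero
    {S : ShortComplex C} (hS : S.ShortExact) {M : C} (h : ∀ e : Ext.{w} M S.X₁ 1, e = 0)
    (g : M ⟶ S.X₃) : ∃ g' : M ⟶ S.X₂, g' ≫ S.g = g := by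
  obtain ⟨x, hx⟩ := Ext.covariant_sequence_exact₃ M hS (Ext.mk₀ g) (zero_add 1) (h _)
  obtain ⟨g', rfl⟩ := (Ext.mk₀_bijective M S.X₂).2 x
  refine ⟨g', (Ext.mk₀_bijective M S.X₃).1 ?_⟩
  rw [← hx, Ext.mk₀_comp_mk₀]

/-- `Ext¹(S.X₃, Y)` vanishes if and only if all maps `S.X₁ ⟶ Y` extend to the projective
object `S.X₂`. -/
theorem CategoryTheory.ShortComplex.ShortExact.ext_one_eq_zero_iff
    {S : ShortComplex C} (hS : S.ShortExact) [Projective S.X₂] (Y : C) :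
    (∀ e : Ext.{w} S.X₃ Y 1, e = 0) ↔ ∀ h : S.X₁ ⟶ Y, ∃ g : S.X₂ ⟶ Y, S.f ≫ g = h := by
  constructor
  · intro H h
    obtain ⟨x, hx⟩ := Ext.contravariant_sequence_exact₁ hS Y (Ext.mk₀ h) (add_zero 1) (H _)
    obtain ⟨g, rfl⟩ := (Ext.mk₀_bijective S.X₂ Y).2 x
    refine ⟨g, (Ext.mk₀_bijective S.X₁ Y).1 ?_⟩
    rw [← hx, Ext.mk₀_comp_mk₀]
  · intro H e
    obtain ⟨x, rfl⟩ := Ext.contravariant_sequence_exact₃ hS Y e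
      (Ext.eq_zero_of_projective _) (add_zero 1)
    obtain ⟨h, rfl⟩ := (Ext.mk₀_bijective S.X₁ Y).2 x
    obtain ⟨g, rfl⟩ := H h
    rw [← Ext.mk₀_comp_mk₀, hS.extClass_comp_assoc]

end Ext

section Module

variable {A : Type u} [Ring A]

theorem LinearMap.exists_lift_of_ext_one_eq_zero {M X Y : ModuleCat.{u} A} (π : X →ₗ[A] Y)
    (hπ : Function.Surjective π)
    (h : ∀ e : Abelian.Ext.{u} M (ModuleCat.of A (LinearMap.ker π)) 1, e = 0) (g : M →ₗ[A] Y) :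
    ∃ g' : M →ₗ[A] X, π ∘ₗ g' = g := by
  obtain ⟨g', hg'⟩ :=
    (LinearMap.shortExact_shortComplexKer hπ).exists_lift_of_ext_one_eq_zero h (ModuleCat.ofHom g)
  exact ⟨g'.hom, congrArg ModuleCat.Hom.hom hg'⟩

theorem LinearMap.ext_one_eq_zero_iff {P M : ModuleCat.{u} A} [Module.Projective A P]
    (p : P →ₗ[A] M) (hp : Function.Surjective p) (Y : ModuleCat.{u} A) :
    (∀ e : Abelian.Ext.{u} M Y 1, e = 0) ↔
      ∀ h : LinearMap.ker p →ₗ[A] Y, ∃ g : P →ₗ[A] Y, g ∘ₗ (LinearMap.ker p).subtype = h := by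
  have hS := LinearMap.shortExact_shortComplexKer hp
  have : Projective p.shortComplexKer.X₂ := (IsProjective.iff_projective P).1 ‹_›
  refine (hS.ext_one_eq_zero_iff Y).trans ⟨fun H h ↦ ?_, fun H h ↦ ?_⟩
  · obtain ⟨g, hg⟩ := H (ModuleCat.ofHom h)
    exact ⟨g.hom, congrArg ModuleCat.Hom.hom hg⟩
  · obtain ⟨g, hg⟩ := H h.hom
    exact ⟨ModuleCat.ofHom g, ModuleCat.hom_ext hg⟩

end Module

/-! ### Ext¹ and extension of maps along a minimal presentation -/

section Presentation

variable {A : Type u} [Ring A]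

/-- If maps into `N` extend along `f`, then so do maps into quotients of powers of `N`. -/
theorem LinearMap.exists_extension_of_surjective_pi {P Q N X : Type*} [AddCommGroup P] [Module A P]
    [AddCommGroup Q] [Module A Q] [AddCommGroup N] [Module A N] [AddCommGroup X] [Module A X]
    [Module.Projective A P] {f : P →ₗ[A] Q}
    (H : ∀ h : P →ₗ[A] N, ∃ k : Q →ₗ[A] N, k ∘ₗ f = h) {ι : Type*} (q : (ι → N) →ₗ[A] X)
    (hq : Function.Surjective q) (h : P →ₗ[A] X) : ∃ k : Q →ₗ[A] X, k ∘ₗ f = h := by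
  obtain ⟨h', rfl⟩ := Module.projective_lifting_property q h hq
  choose k hk using fun i ↦ H (LinearMap.proj i ∘ₗ h')
  refine ⟨q ∘ₗ LinearMap.pi k, ?_⟩
  ext x
  exact congrArg q (funext fun i ↦ LinearMap.congr_fun (hk i) x)

namespace MinProjPresentation

variable {M : FGModuleCat.{u} A} (P : MinProjPresentation A M)

/-- `Ext¹(M, X)` vanishes if all maps `P₁ → X` extend to `P₀`. -/
theorem ext_one_eq_zero {X : FGModuleCat.{u} A}
    (H : ∀ h : P.P₁ →ₗ[A] X, ∃ k : P.P₀ →ₗ[A] X, k ∘ₗ P.f = h)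
    (e : Abelian.Ext.{u} M.obj X.obj 1) : e = 0 := by
  have := P.projective₀
  refine (LinearMap.ext_one_eq_zero_iff (P := P.P₀.obj) (M := M.obj) P.p P.surjective_p X.obj).2
    (fun h ↦ ?_) e
  have hf (x) : P.f x ∈ LinearMap.ker P.p := P.exact ▸ LinearMap.mem_range_self P.f x
  obtain ⟨k, hk⟩ := H (h ∘ₗ P.f.codRestrict _ hf)
  refine ⟨k, LinearMap.ext fun ⟨y, hy⟩ ↦ ?_⟩
  obtain ⟨x, rfl⟩ : y ∈ LinearMap.range P.f := P.exact ▸ hy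
  exact LinearMap.congr_fun hk x

/-- If `Ext¹(M, -)` vanishes on the quotients of `N`, then all maps `P₁ → N` extend to `P₀`. -/
theorem exists_extension {N : FGModuleCat.{u} A}
    (H : ∀ (S : Submodule A N)
      (e : Abelian.Ext.{u} M.obj (ModuleCat.of A (N ⧸ S)) 1), e = 0)
    (h : P.P₁ →ₗ[A] N) : ∃ k : P.P₀ →ₗ[A] N, k ∘ₗ P.f = h := by
  have := P.projective₀
  -- Dividing by the image of ker f is what lets `h` descend to P₁ / ker f ≅ ker p, where
  -- Ext-vanishing applies.
  let S : Submodule A N := (LinearMap.ker P.f).map h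
  let h₁ : (P.P₁ ⧸ LinearMap.ker P.f) →ₗ[A] N ⧸ S :=
    Submodule.mapQ _ _ h (Submodule.le_comap_map h _)
  let e := P.f.quotKerEquivRange.trans (LinearEquiv.ofEq _ _ P.exact)
  obtain ⟨g, hg⟩ := (LinearMap.ext_one_eq_zero_iff (P := P.P₀.obj) (M := M.obj) P.p P.surjective_p
    (ModuleCat.of A (N ⧸ S))).1 (H S) (h₁ ∘ₗ e.symm.toLinearMap)
  have hgf (x : P.P₁) : g (P.f x) = S.mkQ (h x) := by
    have := LinearMap.congr_fun hg (e (Submodule.Quotient.mk x))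
    simp only [LinearMap.comp_apply, LinearEquiv.coe_coe, LinearEquiv.symm_apply_apply] at this
    exact this
  obtain ⟨k, hk⟩ := Module.projective_lifting_property S.mkQ g S.mkQ_surjective
  have hS (x : P.P₁) : (h - k ∘ₗ P.f) x ∈ S := by
    rw [← Submodule.ker_mkQ S, LinearMap.mem_ker, LinearMap.sub_apply, map_sub, ← hgf,
      ← LinearMap.congr_fun hk, LinearMap.comp_apply, LinearMap.comp_apply, sub_self]
  -- The error h - k ∘ f takes values in h(ker f) and agrees with `h` on ker f, so its kernel
  -- together with the superfluous ker f spans `P₁`.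
  have htop : LinearMap.ker (h - k ∘ₗ P.f) = ⊤ := by
    refine P.superfluous_f _ (eq_top_iff.2 fun x _ ↦ ?_)
    obtain ⟨z, hz, hzx⟩ := hS x
    refine Submodule.mem_sup.2 ⟨x - z, ?_, z, hz, sub_add_cancel x z⟩
    rw [LinearMap.mem_ker, map_sub, ← hzx, LinearMap.sub_apply _ _ z, LinearMap.comp_apply,
      LinearMap.mem_ker.1 hz, map_zero, sub_zero, sub_self]
  refine ⟨k, LinearMap.ext fun x ↦ ?_⟩
  have : (h - k ∘ₗ P.f) x = 0 := LinearMap.mem_ker.1 (htop ▸ Submodule.mem_top)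
  exact (sub_eq_zero.1 this).symm

end MinProjPresentation

end Presentation

/-! ### Maps into D Tr M -/

section Pairing

variable {A : Type u} [Ring A]

/-- Finitely generated projective modules have a finite dual basis. -/
theorem Module.Projective.exists_dualBasis (P : Type*) [AddCommGroup P] [Module A P]
    [Module.Finite A P] [Module.Projective A P] :
    ∃ (n : ℕ) (x : Fin n → P) (φ : Fin n → P →ₗ[A] A), ∀ y, ∑ i, φ i y • x i = y := by
  obtain ⟨n, f, g, -, -, hfg⟩ := Module.Finite.exists_comp_eq_id_of_projective A P
  refine ⟨n, fun i ↦ f (Pi.single i 1), fun i ↦ LinearMap.proj i ∘ₗ g, fun y ↦ ?_⟩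
  conv_rhs => rw [← LinearMap.id_apply (R := A) y, ← hfg, LinearMap.comp_apply,
    ← Finset.univ_sum_single (g y), map_sum]
  refine Finset.sum_congr rfl fun i _ ↦ ?_
  rw [← map_smul, ← Pi.single_smul, smul_eq_mul, mul_one]
  rfl

variable {K : Type w} [Field K] [Algebra K A]

/-- `Hom_A(N, D Tr M) = 0` if and only if all maps `P₁ → N` extend to `P₀`. -/
theorem MinProjPresentation.hom_dual_transpose_eq_zero_iff {M : Type u} [AddCommGroup M]
    [Module A M] (P : MinProjPresentation A M) (N : Type*) [AddCommGroup N] [Module A N] :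
    (∀ g : N →ₗ[A] StdDual K P.Transpose, g = 0) ↔
      ∀ h : P.P₁ →ₗ[A] N, ∃ k : P.P₀ →ₗ[A] N, k ∘ₗ P.f = h := by
  have := P.projective₀
  have := P.projective₁
  let _ : Module K N := Module.restrictScalars K A N
  have : IsScalarTower K A N := IsScalarTower.restrictScalars K A N
  let mk := (LinearMap.range (homDualMap P.f)).mkQ
  obtain ⟨n, x, φ, hx⟩ := Module.Projective.exists_dualBasis (A := A) P.P₁
  obtain ⟨m, y, ψ, hy⟩ := Module.Projective.exists_dualBasis (A := A) P.P₀
  constructor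
  · intro H
    let R : (P.P₀ →ₗ[A] N) →ₗ[K] (P.P₁ →ₗ[A] N) :=
      { toFun := fun k ↦ k ∘ₗ P.f, map_add' := fun _ _ ↦ rfl, map_smul' := fun _ _ ↦ rfl }
    suffices LinearMap.range R = ⊤ from LinearMap.range_eq_top.1 this
    by_contra hne
    -- If restriction along `f` is not onto, a nonzero functional `Φ` kills its image; `Φ` will be
    -- turned into a map N → D Tr M.
    obtain ⟨Φ, hΦ, hR⟩ := Submodule.exists_le_ker_of_lt_top _ (lt_top_iff_ne_top.2 hne)
    refine hΦ (LinearMap.ext fun h ↦ ?_)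
    let B (v : N) : (P.P₁ →ₗ[A] A) →ₗ[K] K :=
      { toFun := fun χ ↦ Φ (χ.smulRight v)
        map_add' := fun χ χ' ↦ by
          rw [← map_add]; congr 1; ext z; exact add_smul (χ z) (χ' z) v
        map_smul' := fun c χ ↦ by
          rw [RingHom.id_apply, ← map_smul]; congr 1; ext z; exact smul_assoc c (χ z) v }
    -- (χ ∘ f) ⊗ v is the restriction of χ ⊗ v along `f`, so `B v` descends to Tr M.
    have hB (v : N) : (LinearMap.range (homDualMap P.f)).restrictScalars K ≤
        LinearMap.ker (B v) := by
      rintro _ ⟨χ, rfl⟩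
      exact hR ⟨χ.smulRight v, rfl⟩
    let g : N →ₗ[A] StdDual K P.Transpose :=
      { toFun := fun v ↦ (Submodule.liftQ _ (B v) (hB v)).comp
          (Submodule.Quotient.restrictScalarsEquiv K
            (LinearMap.range (homDualMap P.f))).symm.toLinearMap
        map_add' := fun v v' ↦ DFunLike.ext _ _ fun t ↦ by
          obtain ⟨χ, rfl⟩ := Submodule.Quotient.mk_surjective _ t
          change Φ _ = Φ _ + Φ _
          rw [← map_add]; congr 1; ext z; exact smul_add (χ z) v v'
        map_smul' := fun a v ↦ DFunLike.ext _ _ fun t ↦ by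
          obtain ⟨χ, rfl⟩ := Submodule.Quotient.mk_surjective _ t
          change Φ (χ.smulRight (a • v)) = Φ ((MulOpposite.op a • χ).smulRight v)
          congr 1; ext z; exact (mul_smul (χ z) a v).symm }
    have hg (χ : P.P₁ →ₗ[A] A) (v : N) : Φ (χ.smulRight v) = 0 :=
      congrArg (fun F : StdDual K P.Transpose ↦ F (mk χ)) (LinearMap.congr_fun (H g) v)
    -- By the dual basis, rank-one maps span Hom_A(P₁, N), so `Φ` vanishes.
    have hh : h = ∑ i, (φ i).smulRight (h (x i)) := by
      ext z
      conv_lhs => rw [← hx z, map_sum]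
      simp
    rw [hh, map_sum]
    exact Finset.sum_eq_zero fun i _ ↦ hg _ _
  · intro H g
    let ev (t : P.Transpose) : N →+ K :=
      { toFun := fun v ↦ g v t
        map_zero' := by rw [map_zero]; rfl
        map_add' := fun v v' ↦ by rw [map_add]; rfl }
    -- The classes of the φ i generate Tr M, and linearity of `g` moves their coefficients onto `v`.
    have hev (v : N) (χ : P.P₁ →ₗ[A] A) : ev (mk χ) v = ∑ i, ev (mk (φ i)) (χ (x i) • v) := by
      have hχ : χ = ∑ i, MulOpposite.op (χ (x i)) • φ i := by
        ext z
        conv_lhs => rw [← hx z, map_sum]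
        simp
      conv_lhs => rw [hχ, map_sum]
      refine (map_sum (g v) _ _).trans (Finset.sum_congr rfl fun i _ ↦ ?_)
      change (g v) (MulOpposite.op (χ (x i)) • mk (φ i)) = g (χ (x i) • v) (mk (φ i))
      rw [g.map_smul]
      rfl
    refine LinearMap.ext fun v ↦ DFunLike.ext _ _ fun t ↦ ?_
    obtain ⟨χ, rfl⟩ := Submodule.Quotient.mk_surjective _ t
    obtain ⟨k, hk⟩ := H (χ.smulRight v)
    have hkx (i) : χ (x i) • v = ∑ j, ψ j (P.f (x i)) • k (y j) := by
      rw [← LinearMap.smulRight_apply, ← hk, LinearMap.comp_apply]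
      conv_lhs => rw [← hy (P.f (x i)), map_sum]
      simp
    change ev (mk χ) v = 0
    -- After the interchange, each inner sum is `hev` read backwards for ψ j ∘ f, whose class in Tr
    -- M is zero.
    rw [hev, Finset.sum_congr rfl fun i _ ↦ by rw [hkx, map_sum], Finset.sum_comm]
    refine Finset.sum_eq_zero fun j _ ↦ ?_
    have hmk : mk (ψ j ∘ₗ P.f) = 0 :=
      (Submodule.Quotient.mk_eq_zero _).2 ⟨ψ j, rfl⟩
    refine (hev (k (y j)) (ψ j ∘ₗ P.f)).symm.trans ?_
    rw [hmk]
    exact map_zero (g (k (y j)))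

end Pairing

/-! ### The class gen M: torsion pair and approximations -/

section Gen

variable {A : Type u} [Ring A]

/-- A module is generated by `N` if it is a quotient of a finite power of `N`. -/
def IsGeneratedBy (N X : Type*) [AddCommGroup N] [Module A N] [AddCommGroup X] [Module A X] :
    Prop :=
  ∃ (n : ℕ) (q : (Fin n → N) →ₗ[A] X), Function.Surjective q

namespace IsGeneratedBy

variable {N X Y : Type*} [AddCommGroup N] [Module A N] [AddCommGroup X] [Module A X]
  [AddCommGroup Y] [Module A Y]

theorem of_surjective (h : IsGeneratedBy (A := A) N X) (f : X →ₗ[A] Y)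
    (hf : Function.Surjective f) : IsGeneratedBy (A := A) N Y := by
  obtain ⟨n, q, hq⟩ := h
  exact ⟨n, f ∘ₗ q, hf.comp hq⟩

theorem prod (hX : IsGeneratedBy (A := A) N X) (hY : IsGeneratedBy (A := A) N Y) :
    IsGeneratedBy (A := A) N (X × Y) := by
  obtain ⟨n, q, hq⟩ := hX
  obtain ⟨m, r, hr⟩ := hY
  refine ⟨n + m, (q ∘ₗ LinearMap.funLeft A N (Fin.castAdd m)).prod
    (r ∘ₗ LinearMap.funLeft A N (Fin.natAdd n)), fun ⟨x, y⟩ ↦ ?_⟩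
  obtain ⟨v, rfl⟩ := hq x
  obtain ⟨v', rfl⟩ := hr y
  refine ⟨Fin.append v v', Prod.ext (congrArg q ?_) (congrArg r ?_)⟩
  · ext i; exact Fin.append_left v v' i
  · ext i; exact Fin.append_right v v' i

variable (A N) in
theorem refl : IsGeneratedBy (A := A) N N :=
  ⟨1, LinearMap.proj 0, fun v ↦ ⟨fun _ ↦ v, rfl⟩⟩

/-- A submodule containing the images of all maps from `N` contains the images of all maps from
modules generated by `N`. -/
theorem range_le (hX : IsGeneratedBy (A := A) N X) {T : Submodule A Y}
    (hT : ∀ g : N →ₗ[A] Y, LinearMap.range g ≤ T) (g : X →ₗ[A] Y) : LinearMap.range g ≤ T := by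
  obtain ⟨n, q, hq⟩ := hX
  rintro _ ⟨x, rfl⟩
  obtain ⟨v, rfl⟩ := hq x
  rw [← Finset.univ_sum_single v, map_sum, map_sum]
  exact sum_mem fun i _ ↦ hT (g ∘ₗ q ∘ₗ LinearMap.single A (fun _ ↦ N) i) ⟨v i, rfl⟩

theorem hom_eq_zero (hX : IsGeneratedBy (A := A) N X) (hY : ∀ g : N →ₗ[A] Y, g = 0)
    (g : X →ₗ[A] Y) : g = 0 :=
  LinearMap.range_eq_bot.1 <| le_bot_iff.1 <|
    hX.range_le (fun f ↦ (LinearMap.range_eq_bot.2 (hY f)).le) g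

end IsGeneratedBy

theorem isModuleClass_isGeneratedBy (N : FGModuleCat.{u} A) :
    IsModuleClass fun X : FGModuleCat.{u} A ↦ IsGeneratedBy (A := A) N X where
  iso _ _ := fun ⟨e⟩ h ↦ h.of_surjective e.toLinearMap e.surjective
  sum _ _ := ⟨fun h ↦ h.1.prod h.2, fun h ↦
    ⟨h.of_surjective (LinearMap.fst A _ _) Prod.fst_surjective, h.of_surjective (LinearMap.snd A _ _) Prod.snd_surjective⟩⟩

theorem addClass_pi (N : FGModuleCat.{u} A) (n : ℕ) :
    addClass N (FGModuleCat.of A (Fin n → N)) := by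
  intro C hC hN
  induction n with
  | zero =>
    -- The zero module belongs to every module class containing N, being a summand of N ≅ N × 0.
    refine ((hC.sum N (FGModuleCat.of A (Fin 0 → N))).2 (hC.iso N _ ⟨?_⟩ hN)).2
    exact (LinearEquiv.prodUnique (R := A) (M := N) (M₂ := Fin 0 → N)).symm
  | succ n ih =>
    exact hC.iso _ _ ⟨Fin.consLinearEquiv A fun _ ↦ N⟩ ((hC.sum _ _).1 ⟨hN, ih⟩)

theorem genClass_iff {N X : FGModuleCat.{u} A} :
    genClass N X ↔ IsGeneratedBy (A := A) N X := by
  constructor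
  · rintro ⟨M₀, h, q, hq⟩
    exact (h _ (isModuleClass_isGeneratedBy N) (.refl A N)).of_surjective q hq
  · rintro ⟨n, q, hq⟩
    exact ⟨FGModuleCat.of A (Fin n → N), addClass_pi N n, q, hq⟩

theorem genClass_eq (N : FGModuleCat.{u} A) :
    genClass N = fun X : FGModuleCat.{u} A ↦ IsGeneratedBy (A := A) N X :=
  funext fun _ ↦ propext genClass_iff

/-- The trace of `N` in a Noetherian module `X` is generated by `N`. -/
theorem exists_trace (N X : Type*) [AddCommGroup N] [Module A N] [AddCommGroup X] [Module A X]
    [IsNoetherian A X] : ∃ T : Submodule A X, IsGeneratedBy (A := A) N T ∧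
      ∀ g : N →ₗ[A] X, LinearMap.range g ≤ T := by
  let s : Set (Submodule A X) := {T | ∃ (n : ℕ) (q : (Fin n → N) →ₗ[A] X), LinearMap.range q = T}
  obtain ⟨_, ⟨n, q, rfl⟩, hmax⟩ := set_has_maximal_iff_noetherian.2 ‹IsNoetherian A X› s
    ⟨_, 0, 0, rfl⟩
  refine ⟨LinearMap.range q, ⟨n, q.rangeRestrict, q.surjective_rangeRestrict⟩, fun g ↦ ?_⟩
  -- One extra copy of N adjoins the image of `g`; maximality then forces the image of `g` into that
  -- of `q`.
  let r : (Fin (n + 1) → N) →ₗ[A] X :=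
    g ∘ₗ LinearMap.proj 0 + q ∘ₗ LinearMap.funLeft A N Fin.succ
  have hqr : LinearMap.range q ≤ LinearMap.range r := by
    rintro _ ⟨v, rfl⟩
    refine ⟨Fin.cons 0 v, ?_⟩
    change g 0 + q v = q v
    rw [map_zero, zero_add]
  rw [eq_of_le_of_not_lt hqr (hmax _ ⟨_, r, rfl⟩)]
  rintro _ ⟨v, rfl⟩
  refine ⟨Fin.cons v 0, ?_⟩
  change g v + q 0 = g v
  rw [map_zero, add_zero]

theorem isModuleClass_hom_eq_zero (N : FGModuleCat.{u} A) :
    IsModuleClass fun Y : FGModuleCat.{u} A ↦ ∀ g : N →ₗ[A] Y, g = 0 where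
  iso X Y := fun ⟨e⟩ h g ↦ by
    ext v
    apply e.symm.injective
    rw [LinearMap.zero_apply, map_zero]
    exact LinearMap.congr_fun (h (e.symm.toLinearMap ∘ₗ g)) v
  sum X Y := by
    refine ⟨fun h g ↦ LinearMap.ext fun v ↦ Prod.ext
      (LinearMap.congr_fun (h.1 (LinearMap.fst A X Y ∘ₗ g)) v)
      (LinearMap.congr_fun (h.2 (LinearMap.snd A X Y ∘ₗ g)) v), fun h ↦ ⟨fun g ↦ ?_, fun g ↦ ?_⟩⟩
    · exact LinearMap.ext fun v ↦
        congrArg Prod.fst (LinearMap.congr_fun (h (LinearMap.inl A X Y ∘ₗ g)) v)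
    · exact LinearMap.ext fun v ↦
        congrArg Prod.snd (LinearMap.congr_fun (h (LinearMap.inr A X Y ∘ₗ g)) v)

/-- If `Ext¹(M, gen M) = 0`, then `gen M` is a torsion class. -/
theorem isTorsionClass_genClass [IsNoetherianRing A] {M : FGModuleCat.{u} A}
    (hM : ExtOneVanishes M (genClass M)) : IsTorsionClass (genClass M) := by
  refine ⟨fun Y ↦ ∀ g : M →ₗ[A] Y, g = 0, genClass_eq M ▸ isModuleClass_isGeneratedBy M,
    isModuleClass_hom_eq_zero M, fun X Y hX hY g ↦ (genClass_iff.1 hX).hom_eq_zero hY g,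
    fun X ↦ ?_⟩
  obtain ⟨T, hT, hle⟩ := exists_trace (A := A) M X
  refine ⟨FGModuleCat.of A T, FGModuleCat.of A (X ⧸ T), genClass_iff.2 hT, fun g ↦ ?_,
    T.subtype, T.mkQ, T.injective_subtype, LinearMap.exact_subtype_mkQ T, T.mkQ_surjective⟩
  -- Since this kernel is T, which lies in gen M, Ext-vanishing lifts `g` to X, and the lift lands
  -- in the trace T.
  have hker : genClass M (FGModuleCat.of A (LinearMap.ker T.mkQ)) :=
    genClass_iff.2 (hT.of_surjective _ (LinearEquiv.ofEq T _ T.ker_mkQ.symm).surjective)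
  obtain ⟨g', rfl⟩ := LinearMap.exists_lift_of_ext_one_eq_zero (M := M.obj) (X := X.obj)
    (Y := ModuleCat.of A (X ⧸ T)) T.mkQ T.mkQ_surjective (hM _ hker) g
  exact LinearMap.ext fun v ↦ (Submodule.Quotient.mk_eq_zero T).2 (hle g' ⟨v, rfl⟩)

theorem isContravariantlyFinite_genClass [IsNoetherianRing A] (M : FGModuleCat.{u} A) :
    IsContravariantlyFinite (genClass M) := by
  intro X
  obtain ⟨T, hT, hle⟩ := exists_trace (A := A) M X
  refine ⟨FGModuleCat.of A T, T.subtype, genClass_iff.2 hT, fun Z hZ g ↦ ?_, fun β hβ ↦ ?_⟩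
  · exact ⟨g.codRestrict T fun z ↦ (genClass_iff.1 hZ).range_le hle g ⟨z, rfl⟩, rfl⟩
  · have : β = LinearMap.id := LinearMap.ext fun x ↦ Subtype.ext (LinearMap.congr_fun hβ x)
    rw [this]
    exact Function.bijective_id

/-- Over a finite-dimensional algebra, all maps `P → N` factor through a single map from `P` to a
finite power of `N`. -/
theorem Module.Finite.exists_hom_approximation (K : Type w) [Field K] [Algebra K A]
    [Module.Finite K A] (P N : Type*) [AddCommGroup P] [Module A P] [Module.Finite A P]
    [AddCommGroup N] [Module A N] [Module.Finite A N] :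
    ∃ (n : ℕ) (θ : P →ₗ[A] Fin n → N), ∀ g : P →ₗ[A] N, ∃ g' : (Fin n → N) →ₗ[A] N,
      g' ∘ₗ θ = g := by
  let _ : Module K N := Module.restrictScalars K A N
  have : IsScalarTower K A N := IsScalarTower.restrictScalars K A N
  let _ : Module K P := Module.restrictScalars K A P
  have : IsScalarTower K A P := IsScalarTower.restrictScalars K A P
  have : Module.Finite K N := Module.Finite.trans A N
  have : Module.Finite K P := Module.Finite.trans A P
  have : Module.Finite K (P →ₗ[A] N) :=
    Module.Finite.of_injective (LinearMap.restrictScalarsₗ K A P N K)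
      (LinearMap.restrictScalars_injective K)
  obtain ⟨n, s, hs⟩ := Module.Finite.exists_fin (R := K) (M := P →ₗ[A] N)
  refine ⟨n, LinearMap.pi s, fun g ↦ ?_⟩
  have hg : g ∈ Submodule.span K (Set.range s) := hs ▸ Submodule.mem_top
  obtain ⟨c, rfl⟩ := (Submodule.mem_span_range_iff_exists_fun K).1 hg
  refine ⟨∑ i, c i • LinearMap.proj i, ?_⟩
  ext x
  simp

/-- Every module has a left `gen M`-approximation. -/
theorem exists_left_approximation (K : Type w) [Field K] [Algebra K A] [Module.Finite K A]
    (M X : FGModuleCat.{u} A) : ∃ (Y : FGModuleCat.{u} A) (θ : X →ₗ[A] Y), genClass M Y ∧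
      ∀ Z : FGModuleCat.{u} A, genClass M Z → ∀ g : X →ₗ[A] Z, ∃ g' : Y →ₗ[A] Z, g' ∘ₗ θ = g := by
  obtain ⟨m, π, hπ⟩ := Module.Finite.exists_fin' A X
  obtain ⟨n, θ, hθ⟩ := Module.Finite.exists_hom_approximation K (A := A) (Fin m → A) M
  -- The approximation `θ` of a free cover of X is pushed out along `π`.
  let L : Submodule A (Fin n → M) := (LinearMap.ker π).map θ
  let e := π.quotKerEquivOfSurjective hπ
  refine ⟨FGModuleCat.of A ((Fin n → M) ⧸ L),
    Submodule.mapQ _ L θ (Submodule.le_comap_map θ _) ∘ₗ e.symm.toLinearMap,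
    genClass_iff.2 ⟨n, L.mkQ, L.mkQ_surjective⟩, fun Z hZ g ↦ ?_⟩
  obtain ⟨k, r, hr⟩ := genClass_iff.1 hZ
  obtain ⟨G, hG⟩ := LinearMap.exists_extension_of_surjective_pi hθ r hr (g ∘ₗ π)
  refine ⟨L.liftQ G ?_, LinearMap.ext fun x ↦ ?_⟩
  · rintro _ ⟨x, hx, rfl⟩
    rw [LinearMap.mem_ker, ← LinearMap.comp_apply, hG, LinearMap.comp_apply,
      LinearMap.mem_ker.1 hx, map_zero]
  · obtain ⟨y, rfl⟩ := hπ x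
    have : e.symm (π y) = Submodule.Quotient.mk y := e.symm_apply_eq.2 rfl
    rw [LinearMap.comp_apply, LinearMap.comp_apply, LinearEquiv.coe_coe, this]
    exact LinearMap.congr_fun hG y

/-- A left approximation of least length is left minimal: if α ∘ θ = θ, the image of `α` is again an
approximation, so `α` is onto, hence bijective. -/
theorem isCovariantlyFinite_genClass (K : Type w) [Field K] [Algebra K A] [Module.Finite K A]
    (M : FGModuleCat.{u} A) : IsCovariantlyFinite (genClass M) := by
  intro X
  have : IsArtinianRing A := .of_finite K A
  let s : Set ℕ∞ := {l | ∃ (Y : FGModuleCat.{u} A) (θ : X →ₗ[A] Y), (genClass M Y ∧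
    ∀ Z : FGModuleCat.{u} A, genClass M Z → ∀ g : X →ₗ[A] Z, ∃ g' : Y →ₗ[A] Z, g' ∘ₗ θ = g) ∧
    Module.length A Y = l}
  have hs : s.Nonempty := by
    obtain ⟨Y, θ, h⟩ := exists_left_approximation K M X
    exact ⟨_, Y, θ, h, rfl⟩
  obtain ⟨_, ⟨Y, θ, ⟨hY, hfac⟩, rfl⟩, hmin⟩ := wellFounded_lt.has_min s hs
  refine ⟨Y, θ, hY, hfac, fun α hα ↦ ?_⟩
  apply IsNoetherian.bijective_of_surjective_endomorphism
  rw [← LinearMap.range_eq_top]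
  by_contra hne
  refine hmin _ ⟨FGModuleCat.of A (LinearMap.range α), α.rangeRestrict ∘ₗ θ, ⟨?_, ?_⟩, rfl⟩
    (Submodule.length_lt hne)
  · exact genClass_iff.2 ((genClass_iff.1 hY).of_surjective _ α.surjective_rangeRestrict)
  · intro Z hZ g
    obtain ⟨g', rfl⟩ := hfac Z hZ g
    refine ⟨g' ∘ₗ (LinearMap.range α).subtype, LinearMap.ext fun x ↦ congrArg g' ?_⟩
    exact LinearMap.congr_fun hα x

end Gen

theorem hom_arTranslate_eq_zero_iff {K : Type w} [Field K] {A : Type u} [Ring A] [Algebra K A]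
    [Module.Finite K A] (M N : FGModuleCat.{u} A) :
    (∀ g : N →ₗ[A] ARTranslate K M, g = 0) ↔ ExtOneVanishes M (genClass N) := by
  have := (minProjPresentation K M).projective₁
  refine ((minProjPresentation K M).hom_dual_transpose_eq_zero_iff N).trans ⟨fun H X hX ↦ ?_,
    fun H ↦ (minProjPresentation K M).exists_extension fun S ↦
      H (FGModuleCat.of A (N ⧸ S)) (genClass_iff.2 ?_)⟩
  · obtain ⟨n, q, hq⟩ := genClass_iff.1 hX
    exact (minProjPresentation K M).ext_one_eq_zero
      (LinearMap.exists_extension_of_surjective_pi H q hq)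
  · exact (IsGeneratedBy.refl A N).of_surjective S.mkQ S.mkQ_surjective

theorem mainTheorem9 {K : Type w} [Field K] [IsAlgClosed K] {A : Type u} [Ring A] [Algebra K A]
    [Module.Finite K A] :
    (∀ M N : FGModuleCat.{u} A,
      (∀ g : N →ₗ[A] ARTranslate K M, g = 0) ↔ ExtOneVanishes M (genClass N)) ∧
    (∀ M : FGModuleCat.{u} A,
      (IsTauRigid K M ↔ ExtOneVanishes M (genClass M)) ∧
      (IsTauRigid K M → IsTorsionClass (genClass M) ∧ IsFunctoriallyFinite (genClass M))) := by
  have : IsArtinianRing A := .of_finite K A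
  refine ⟨hom_arTranslate_eq_zero_iff, fun M ↦ ⟨hom_arTranslate_eq_zero_iff M M, fun h ↦
    ⟨isTorsionClass_genClass ((hom_arTranslate_eq_zero_iff M M).1 h),
      isCovariantlyFinite_genClass K M, isContravariantlyFinite_genClass M⟩⟩⟩
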